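/- Let $\mathcal{L} = \{+, -, 0, <, \rho\cdot, \rho^{-1}\cdot\}$ be the language of ordered groups with two additional unary function symbols $\rho\cdot$ and $\rho^{-1}\cdot$. For $L = \sum_{i=0}^{k} m_i\rho^i \in \mathbb{Z}[\rho]$ (a polynomial in the formal variable $\rho$) write $L\cdot x := \sum_{i=0}^{k} m_i(\rho^i\cdot x)$, where $\rho^i\cdot x$ is the result of applying $\rho\cdot$ to $x$ exactly $i$ times; such an $L$ is called a linear difference operator. Let $MODAG$ be the $\mathcal{L}$-theory of multiplicative ordered difference abelian groups, which is axiomatized by: the axioms of abelian groups; the axioms of strict linear orders; $x<y \Rightarrow x+z<y+z$, $x<y\Rightarrow \rho\cdot x<\rho\cdot y$ and $x<y\Rightarrow\rho^{-1}\cdot x<\rho^{-1}\cdot y$; $\rho\cdot$ and $\rho^{-1}\cdot$ are group endomorphisms inverse to each other; and, for each $L\in\mathbb{Z}[\rho]$, Axiom OM: $$\Big(\forall x>0\,(L\cdot x>0)\Big)\vee\Big(\forall x>0\,(L\cdot x=0)\Big)\vee\Big(\forall x>0\,(L\cdot x<0)\Big).$$ Let $MODDAG$ be the $\mathcal{L}$-theory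 of nontrivial multiplicative ordered divisible difference abelian groups, which is axiomatized by $MODAG$ together with $\exists x\,(x\neq 0)$ and, for each $L\in\mathbb{Z}[\rho]$, the axiom $$\Big(\forall x\,(L\cdot x=0)\Big)\vee\Big(\forall x\,\exists y\,(L\cdot y=x)\Big).$$ Theorem. $MODDAG$ is the model companion of $MODAG$. That is, every model of $MODAG$ embeds into a model of $MODDAG$, every model of $MODDAG$ embeds into a model of $MODAG$, and $MODDAG$ is model complete: every embedding between models of $MODDAG$ is elementary. -/

import Mathlib

namespace FirstOrder.Language

/-- A theory is model complete if every embedding between two of its models is elementary. -/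
def Theory.IsModelComplete.{u, v, w} {L : Language.{u, v}} (T : L.Theory) : Prop :=
  ∀ (M N : Type w) [L.Structure M] [L.Structure N] [Nonempty M] [Nonempty N] [M ⊨ T] [N ⊨ T]
    (f : M ↪[L] N) (n : ℕ) (φ : L.Formula (Fin n)) (x : Fin n → M),
    φ.Realize (f ∘ x) ↔ φ.Realize x

/-- Every model of `T` embeds into a model of `T'`. -/
def Theory.ModelsEmbedInto.{u, v, w} {L : Language.{u, v}} (T T' : L.Theory) : Prop :=
  ∀ (M : Type w) [L.Structure M] [Nonempty M] [M ⊨ T],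
    ∃ (N : Type w) (_ : L.Structure N) (_ : Nonempty N) (_ : N ⊨ T'), Nonempty (M ↪[L] N)

/-- `T'` is a model companion of `T`: the two theories are co-theories (every model of either one
embeds into a model of the other one), and `T'` is model complete. -/
structure Theory.IsModelCompanion.{u, v, w} {L : Language.{u, v}} (T' T : L.Theory) : Prop where
  embeds : Theory.ModelsEmbedInto.{u, v, w} T T'
  embeds' : Theory.ModelsEmbedInto.{u, v, w} T' T
  modelComplete : Theory.IsModelComplete.{u, v, w} T'

end FirstOrder.Language

namespace OrderedDifferenceGroup

open FirstOrder FirstOrder.Language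

/-- The function symbols `0`, `-` (unary), `ρ·`, `ρ⁻¹·` and `+`. -/
inductive Func : ℕ → Type
  | zero : Func 0
  | neg : Func 1
  | rho : Func 1
  | rhoInv : Func 1
  | add : Func 2

/-- The relation symbol `<`. -/
inductive Rel : ℕ → Type
  | lt : Rel 2

/-- The language `{+, -, 0, <, ρ·, ρ⁻¹·}` of ordered difference groups. -/
def lang : Language := ⟨Func, Rel⟩

section Terms

variable {α : Type}

def zeroT : lang.Term α := Constants.term (L := lang) Func.zero

def negT (t : lang.Term α) : lang.Term α := Functions.apply₁ (L := lang) Func.neg t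

def rhoT (t : lang.Term α) : lang.Term α := Functions.apply₁ (L := lang) Func.rho t

def rhoInvT (t : lang.Term α) : lang.Term α := Functions.apply₁ (L := lang) Func.rhoInv t

def addT (s t : lang.Term α) : lang.Term α := Functions.apply₂ (L := lang) Func.add s t

/-- The atomic formula `s < t`. -/
def ltF {n : ℕ} (s t : lang.Term (α ⊕ Fin n)) : lang.BoundedFormula α n :=
  Relations.boundedFormula₂ (L := lang) Rel.lt s t

/-- The term `m t = t + ⋯ + t` for a natural number `m`. -/
def natMulT : ℕ → lang.Term α → lang.Term α
  | 0, _ => zeroT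
  | m + 1, t => addT (natMulT m t) t

/-- The term `m t` for an integer `m`, with `(-m) t = -(m t)`. -/
def intMulT : ℤ → lang.Term α → lang.Term α
  | Int.ofNat m, t => natMulT m t
  | Int.negSucc m, t => negT (natMulT (m + 1) t)

/-- The term `ρ · ρ ⋯ ρ · t` with `i` occurrences of `ρ`. -/
def rhoPowT : ℕ → lang.Term α → lang.Term α
  | 0, t => t
  | i + 1, t => rhoT (rhoPowT i t)

/-- The partial sum of the terms `mᵢ (ρⁱ · t)` over `i < k`, where `mᵢ` is the `i`-th coefficient
of `p`. -/
noncomputable def partialOpT (p : Polynomial ℤ) (t : lang.Term α) : ℕ → lang.Term α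
  | 0 => zeroT
  | k + 1 => addT (partialOpT p t k) (intMulT (p.coeff k) (rhoPowT k t))

/-- The term `p · t`: the linear difference operator given by the integer polynomial
`p = ∑ mᵢ ρⁱ`, applied to `t`. -/
noncomputable def opT (p : Polynomial ℤ) (t : lang.Term α) : lang.Term α :=
  partialOpT p t (p.natDegree + 1)

end Terms

/-- The axioms of abelian groups. -/
def abelianGroupAxioms : lang.Theory :=
  { ∀' ∀' ∀' (addT (addT (&0) (&1)) (&2) =' addT (&0) (addT (&1) (&2))),
    ∀' ∀' (addT (&0) (&1) =' addT (&1) (&0)),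
    ∀' (addT (&0) zeroT =' &0),
    ∀' (addT (&0) (negT (&0)) =' zeroT) }

/-- The axioms of (strict) linear orders. -/
def linearOrderAxioms : lang.Theory :=
  { ∀' ∼(ltF (&0) (&0)),
    ∀' ∀' ∀' (ltF (&0) (&1) ⟹ ltF (&1) (&2) ⟹ ltF (&0) (&2)),
    ∀' ∀' (ltF (&0) (&1) ⊔ (&0 =' &1) ⊔ ltF (&1) (&0)) }

/-- Compatibility of the order with `+`, `ρ·` and `ρ⁻¹·`. -/
def orderCompatibilityAxioms : lang.Theory :=
  { ∀' ∀' ∀' (ltF (&0) (&1) ⟹ ltF (addT (&0) (&2)) (addT (&1) (&2))),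
    ∀' ∀' (ltF (&0) (&1) ⟹ ltF (rhoT (&0)) (rhoT (&1))),
    ∀' ∀' (ltF (&0) (&1) ⟹ ltF (rhoInvT (&0)) (rhoInvT (&1))) }

/-- `ρ·` and `ρ⁻¹·` are endomorphisms of the group, inverse to each other. -/
def automorphismAxioms : lang.Theory :=
  { ∀' ∀' (rhoT (addT (&0) (&1)) =' addT (rhoT (&0)) (rhoT (&1))),
    ∀' ∀' (rhoInvT (addT (&0) (&1)) =' addT (rhoInvT (&0)) (rhoInvT (&1))),
    ∀' (rhoT (rhoInvT (&0)) =' &0),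
    ∀' (rhoInvT (rhoT (&0)) =' &0) }

/-- The theory of ordered difference abelian groups. -/
def orderedDifferenceAbelianGroups : lang.Theory :=
  abelianGroupAxioms ∪ linearOrderAxioms ∪ orderCompatibilityAxioms ∪ automorphismAxioms

/-- The instance of Axiom OM for the linear difference operator `p`:
`(∀ x > 0, p · x > 0) ∨ (∀ x > 0, p · x = 0) ∨ (∀ x > 0, p · x < 0)`. -/
noncomputable def axiomOM (p : Polynomial ℤ) : lang.Sentence :=
  (∀' (ltF zeroT (&0) ⟹ ltF zeroT (opT p (&0)))) ⊔
    (∀' (ltF zeroT (&0) ⟹ (opT p (&0) =' zeroT))) ⊔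
    (∀' (ltF zeroT (&0) ⟹ ltF (opT p (&0)) zeroT))

/-- The theory of multiplicative ordered difference abelian groups. -/
def MODAG : lang.Theory :=
  orderedDifferenceAbelianGroups ∪ Set.range axiomOM

/-- The sentence `∃ x, x ≠ 0`. -/
def nontrivialAxiom : lang.Sentence := ∃' ∼(&0 =' zeroT)

/-- The linear difference operator `p` is zero or surjective:
`(∀ x, p · x = 0) ∨ (∀ x, ∃ y, p · y = x)`. -/
noncomputable def divisibilityAxiom (p : Polynomial ℤ) : lang.Sentence :=
  (∀' (opT p (&0) =' zeroT)) ⊔ (∀' ∃' (opT p (&1) =' &0))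

/-- The theory of nontrivial multiplicative ordered divisible difference abelian groups. -/
def MODDAG : lang.Theory :=
  MODAG ∪ {nontrivialAxiom} ∪ Set.range divisibilityAxiom

end OrderedDifferenceGroup

universe w

/-!
In a model of `MODAG` the operators `ρ·` and `ρ⁻¹·` give an action of the Laurent polynomials, and
Axiom OM says that every scalar has a sign, by which it multiplies the signs of all elements.
Inverting the scalars of positive sign keeps this property and makes every scalar of nonzero sign
act surjectively, so a nontrivial model embeds into a model of `MODDAG`.

A linear form in `a` whose leading scalar has nonzero sign has a root in a model of `MODDAG`. Its
sign at `a` depends on the position of `a` relative to this root, and the roots of two forms compare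
through the sign of their resultant, in which `a` no longer occurs. By density of the order, an
element with prescribed signs exists as soon as these resultants and the forms not involving `a`
have matching signs. Going through the quantifiers, the truth of a formula depends only on the
signs of finitely many linear forms in its free variables, and embeddings preserve those signs.
-/

namespace OrderedDifferenceGroup

open FirstOrder FirstOrder.Language LaurentPolynomial SignType
open scoped Polynomial

section Signs

variable {A : Type*} [CommRing A] {σ : A → SignType}
  {V W : Type*} [AddCommGroup V] [LinearOrder V] [Module A V]
  [AddCommGroup W] [LinearOrder W] [Module A W]

/-- The operators given by the elements of `A` on the ordered module `V` all satisfy Axiom OM: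
`p` preserves, annihilates or reverses signs according to whether `σ p` is `1`, `0` or `-1`. -/
def ActsWithSign (σ : A → SignType) (V : Type*) [AddCommGroup V] [LinearOrder V] [Module A V] :
    Prop :=
  ∀ (p : A) (x : V), sign (p • x) = σ p * sign x

/-- An ordered module satisfying Axiom OM with signs `σ`, on which every scalar of nonzero sign acts
surjectively. -/
structure IsSignDivisible (σ : A → SignType) (V : Type*) [AddCommGroup V] [LinearOrder V]
    [Module A V] : Prop where
  actsWithSign : ActsWithSign σ V
  surjective_smul {p : A} : σ p ≠ 0 → Function.Surjective fun x : V ↦ p • x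

variable (A V) in
/-- The scalars acting on the ordered module `V` without changing signs. -/
def positiveScalars : Submonoid A where
  carrier := {p | ∀ x : V, sign (p • x) = sign x}
  one_mem' x := by rw [one_smul]
  mul_mem' hp hq x := by rw [mul_smul, hp, hq]

theorem strictMono_smul [IsOrderedAddMonoid V] {p : A} (hp : p ∈ positiveScalars A V) :
    StrictMono fun x : V ↦ p • x := fun x y hxy ↦ by
  rw [← sub_pos, ← smul_sub, ← sign_eq_one_iff, hp, sign_eq_one_iff, sub_pos]
  exact hxy

theorem ActsWithSign.sign_smul_of_pos (hσ : ActsWithSign σ V) (p : A) {x : V} (hx : 0 < x) :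
    sign (p • x) = σ p := by
  rw [hσ, sign_pos hx, mul_one]

theorem ActsWithSign.smul_eq_zero (hσ : ActsWithSign σ V) {p : A} (hp : σ p = 0) (x : V) :
    p • x = 0 := by
  rw [← sign_eq_zero_iff, hσ, hp, zero_mul]

theorem ActsWithSign.of_strictMono (hσ : ActsWithSign σ W) {f : V →ₗ[A] W} (hf : StrictMono f) :
    ActsWithSign σ V := fun p x ↦ by
  rw [← hf.sign_comp, map_smul, hσ, hf.sign_comp]

theorem exists_pos_of_nontrivial (V : Type*) [AddCommGroup V] [LinearOrder V]
    [IsOrderedAddMonoid V] [Nontrivial V] : ∃ x : V, 0 < x := by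
  obtain ⟨x, hx⟩ := exists_ne (0 : V)
  exact ⟨|x|, abs_pos.2 hx⟩

theorem exists_sign_smul_iff [IsOrderedAddMonoid V] {p : A} :
    (∃ s : SignType, ∀ x : V, sign (p • x) = s * sign x) ↔
      ((∀ x : V, 0 < x → 0 < p • x) ∨ ∀ x : V, 0 < x → p • x = 0) ∨
        ∀ x : V, 0 < x → p • x < 0 := by
  have forall_pos_iff (s : SignType) :
      (∀ x : V, sign (p • x) = s * sign x) ↔ ∀ x : V, 0 < x → sign (p • x) = s := by
    refine ⟨fun h x hx ↦ by rw [h, sign_pos hx, mul_one], fun h x ↦ ?_⟩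
    obtain hx | rfl | hx := lt_trichotomy x 0
    · rw [← neg_neg x, smul_neg, Left.sign_neg, h _ (neg_pos.2 hx), Left.sign_neg,
        sign_pos (neg_pos.2 hx), mul_neg_one]
    · rw [smul_zero, sign_zero, mul_zero]
    · rw [h x hx, sign_pos hx, mul_one]
  simp only [forall_pos_iff]
  constructor
  · rintro ⟨s, hs⟩
    rcases s.trichotomy with rfl | rfl | rfl
    · exact .inr fun x hx ↦ sign_eq_neg_one_iff.1 (hs x hx)
    · exact .inl (.inr fun x hx ↦ sign_eq_zero_iff.1 (hs x hx))
    · exact .inl (.inl fun x hx ↦ sign_eq_one_iff.1 (hs x hx))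
  · rintro ((h | h) | h)
    · exact ⟨1, fun x hx ↦ sign_pos (h x hx)⟩
    · exact ⟨0, fun x hx ↦ sign_eq_zero_iff.2 (h x hx)⟩
    · exact ⟨-1, fun x hx ↦ sign_neg (h x hx)⟩

theorem ActsWithSign.unique [IsOrderedAddMonoid V] [Nontrivial V] {τ : A → SignType}
    (hσ : ActsWithSign σ V) (hτ : ActsWithSign τ V) : σ = τ := by
  obtain ⟨x, hx⟩ := exists_pos_of_nontrivial V
  funext p
  rw [← hσ.sign_smul_of_pos p hx, hτ.sign_smul_of_pos p hx]

theorem IsSignDivisible.denselyOrdered [IsOrderedAddMonoid V] (hσ : IsSignDivisible σ V) :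
    DenselyOrdered V where
  dense a b hab := by
    have : Nontrivial V := ⟨a, b, hab.ne⟩
    obtain ⟨x, hx⟩ := exists_pos_of_nontrivial V
    have two_ne_zero : σ 2 ≠ 0 := by
      rw [← hσ.actsWithSign.sign_smul_of_pos 2 hx, two_smul, sign_pos (add_pos hx hx)]
      decide
    obtain ⟨y, hy : (2 : A) • y = a + b⟩ := hσ.surjective_smul two_ne_zero (a + b)
    rw [two_smul] at hy
    refine ⟨y, lt_of_not_ge fun hya ↦ ?_, lt_of_not_ge fun hby ↦ ?_⟩
    · exact ((add_le_add hya hya).trans_lt (add_lt_add_right hab a)).ne hy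
    · exact ((add_lt_add_left hab b).trans_le (add_le_add hby hby)).ne' hy

end Signs

section Elimination

theorem exists_sign_sub_eq {ι V W : Type*} [AddCommGroup V] [LinearOrder V] [IsOrderedAddMonoid V]
    [AddCommGroup W] [LinearOrder W] [IsOrderedAddMonoid W] [Nontrivial W] [DenselyOrdered W]
    {I : Set ι} (hI : I.Finite) {s : ι → V} {t : ι → W}
    (hst : ∀ i ∈ I, ∀ j ∈ I, sign (s i - s j) = sign (t i - t j)) (a : V) :
    ∃ b : W, ∀ i ∈ I, sign (a - s i) = sign (b - t i) := by
  classical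
  by_cases ha : ∃ i ∈ I, s i = a
  · obtain ⟨i, hi, rfl⟩ := ha
    exact ⟨t i, hst i hi⟩
  push Not at ha
  let lower := {i ∈ hI.toFinset | s i < a}.image t
  let upper := {i ∈ hI.toFinset | a < s i}.image t
  have lower_lt_upper : ∀ l ∈ lower, ∀ u ∈ upper, l < u := by
    simp only [lower, upper, Finset.forall_mem_image, Finset.mem_filter, Set.Finite.mem_toFinset]
    rintro i ⟨hi, hia⟩ j ⟨hj, haj⟩
    rw [← sub_neg, ← sign_eq_neg_one_iff, ← hst i hi j hj, sign_eq_neg_one_iff, sub_neg]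
    exact hia.trans haj
  obtain ⟨b, lower_lt_b, b_lt_upper⟩ := Order.exists_between_finsets lower upper lower_lt_upper
  refine ⟨b, fun i hi ↦ ?_⟩
  rcases lt_or_gt_of_ne (ha i hi) with hia | hai
  · have : t i < b := lower_lt_b _ (Finset.mem_image_of_mem t (by simp [hi, hia]))
    rw [sign_pos (sub_pos.2 hia), sign_pos (sub_pos.2 this)]
  · have : b < t i := b_lt_upper _ (Finset.mem_image_of_mem t (by simp [hi, hai]))
    rw [sign_neg (sub_neg.2 hai), sign_neg (sub_neg.2 this)]

theorem linearCombination_option_elim {A ι V : Type*} [Semiring A] [AddCommMonoid V] [Module A V]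
    (x : ι → V) (a : V) (c : Option ι →₀ A) :
    Finsupp.linearCombination A (Option.elim · a x) c =
      c none • a + Finsupp.linearCombination A x c.some :=
  Finsupp.linearCombination_option A (Option.elim · a x) c

variable {A ι : Type*} [CommRing A] {σ : A → SignType}
  {V W : Type*} [AddCommGroup V] [LinearOrder V] [Module A V]
  [AddCommGroup W] [LinearOrder W] [Module A W]

/-- The linear forms in `S` have the same signs at `x` as at `y`. A linear form in the variables `ι`
is given by its coefficients, as an element of `ι →₀ A`. -/
def SameSigns (S : Set (ι →₀ A)) (x : ι → V) (y : ι → W) : Prop :=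
  ∀ c ∈ S, sign (Finsupp.linearCombination A x c) = sign (Finsupp.linearCombination A y c)

theorem SameSigns.symm {S : Set (ι →₀ A)} {x : ι → V} {y : ι → W} (h : SameSigns S x y) :
    SameSigns S y x :=
  fun c hc ↦ (h c hc).symm

theorem SameSigns.mono {S S' : Set (ι →₀ A)} (hS : S ⊆ S') {x : ι → V} {y : ι → W}
    (h : SameSigns S' x y) : SameSigns S x y :=
  fun c hc ↦ h c (hS hc)

theorem sameSigns_of_strictMono (S : Set (ι →₀ A)) (x : ι → V) {f : V →ₗ[A] W}
    (hf : StrictMono f) : SameSigns S (f ∘ x) x := fun c _ ↦ by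
  rw [← LinearMap.map_finsupp_linearCombination, hf.sign_comp]

/-- The linear forms obtained from those in `S` by eliminating the variable `none`: they are the
forms that remain when `none` is set to `0`, and the resultants of two forms in `S`. -/
def eliminate (S : Set (Option ι →₀ A)) : Set (ι →₀ A) :=
  Finsupp.some '' S ∪ Set.image2 (fun c d ↦ c none • d.some - d none • c.some) S S

theorem eliminate_finite {S : Set (Option ι →₀ A)} (hS : S.Finite) : (eliminate S).Finite :=
  (hS.image _).union (hS.image2 _ hS)

/-- Two linear forms with roots `s` and `t` compare these roots through the sign of their
resultant. -/
theorem ActsWithSign.sign_linearCombination_resultant (hσ : ActsWithSign σ V)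
    {x : ι → V} {c d : Option ι →₀ A} {s t : V}
    (hs : c none • s = -Finsupp.linearCombination A x c.some)
    (ht : d none • t = -Finsupp.linearCombination A x d.some) :
    sign (Finsupp.linearCombination A x (c none • d.some - d none • c.some)) =
      σ (c none) * (σ (d none) * sign (s - t)) := by
  rw [← hσ, ← hσ, smul_sub, smul_sub, smul_comm (c none) (d none) s, hs, ht, map_sub, map_smul,
    map_smul]
  congr 1
  module

theorem ActsWithSign.sign_linearCombination_option (hσ : ActsWithSign σ V)
    {x : ι → V} {c : Option ι →₀ A} {s : V}
    (hs : c none • s = -Finsupp.linearCombination A x c.some) (a : V) :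
    sign (Finsupp.linearCombination A (Option.elim · a x) c) = σ (c none) * sign (a - s) := by
  rw [← hσ, smul_sub, hs, sub_neg_eq_add, linearCombination_option_elim]

theorem SameSigns.exists_extend [IsOrderedAddMonoid V] [IsOrderedAddMonoid W] [Nontrivial W]
    (hV : IsSignDivisible σ V) (hW : IsSignDivisible σ W)
    {S : Set (Option ι →₀ A)} (hS : S.Finite) {x : ι → V} {y : ι → W}
    (hxy : SameSigns (eliminate S) x y) (a : V) :
    ∃ b : W, SameSigns S (Option.elim · a x) (Option.elim · b y) := by
  have := hW.denselyOrdered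
  have exists_rootV (c : Option ι →₀ A) (hc : σ (c none) ≠ 0) :=
    hV.surjective_smul hc (-Finsupp.linearCombination A x c.some)
  have exists_rootW (c : Option ι →₀ A) (hc : σ (c none) ≠ 0) :=
    hW.surjective_smul hc (-Finsupp.linearCombination A y c.some)
  choose! s hs using exists_rootV
  choose! t ht using exists_rootW
  have sign_root_sub : ∀ c ∈ {c ∈ S | σ (c none) ≠ 0}, ∀ d ∈ {c ∈ S | σ (c none) ≠ 0},
      sign (s c - s d) = sign (t c - t d) := by
    rintro c ⟨hcS, hc⟩ d ⟨hdS, hd⟩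
    have h := hxy _ (Or.inr (Set.mem_image2_of_mem hcS hdS))
    rw [hV.actsWithSign.sign_linearCombination_resultant (hs c hc) (hs d hd),
      hW.actsWithSign.sign_linearCombination_resultant (ht c hc) (ht d hd)] at h
    exact mul_left_cancel₀ hd (mul_left_cancel₀ hc h)
  obtain ⟨b, hb⟩ := exists_sign_sub_eq (hS.subset (Set.sep_subset _ _)) sign_root_sub a
  refine ⟨b, fun c hcS ↦ ?_⟩
  by_cases hc : σ (c none) = 0
  · rw [linearCombination_option_elim, linearCombination_option_elim,
      hV.actsWithSign.smul_eq_zero hc, hW.actsWithSign.smul_eq_zero hc, zero_add, zero_add]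
    exact hxy _ (Or.inl (Set.mem_image_of_mem _ hcS))
  · rw [hV.actsWithSign.sign_linearCombination_option (hs c hc),
      hW.actsWithSign.sign_linearCombination_option (ht c hc), hb c ⟨hcS, hc⟩]

end Elimination

section Localization

variable {A V : Type*} [CommRing A] [AddCommGroup V] [LinearOrder V] [Module A V]

theorem sign_positiveScalars_smul (s : positiveScalars A V) (x : V) : sign (s • x) = sign x :=
  s.2 x

theorem smul_localization_surjective {p : A} (hp : p ∈ positiveScalars A V) :
    Function.Surjective fun z : LocalizedModule (positiveScalars A V) V ↦ p • z := fun z ↦ by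
  induction z using LocalizedModule.induction_on with | h m s =>
  refine ⟨LocalizedModule.mk m (⟨p, hp⟩ * s), ?_⟩
  dsimp only
  rw [LocalizedModule.smul'_mk]
  exact LocalizedModule.mk_cancel_common_left ⟨p, hp⟩ s m

/-- The sign of a fraction is the sign of its numerator, as denominators are positive. -/
def fractionSign (z : LocalizedModule (positiveScalars A V) V) : SignType :=
  z.liftOn (fun q ↦ sign q.1) fun _ _ ⟨u, hu⟩ ↦ by
    simpa only [sign_positiveScalars_smul] using congrArg sign hu

@[simp]
theorem fractionSign_mk (m : V) (s : positiveScalars A V) :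
    fractionSign (LocalizedModule.mk m s) = sign m :=
  LocalizedModule.liftOn_mk _ m s

variable [IsOrderedAddMonoid V]

variable (A V) in
/-- The cone of nonnegative fractions, which orders the localization of `V` at its positive
scalars. -/
def fractionCone : AddGroupCone (LocalizedModule (positiveScalars A V) V) where
  carrier := {z | 0 ≤ fractionSign z}
  zero_mem' := by
    rw [Set.mem_ofPred_eq, ← LocalizedModule.zero_mk 1, fractionSign_mk, sign_zero]
  add_mem' {a b} := by
    induction a, b using LocalizedModule.induction_on₂ with | h m m' s s' =>
    simp only [Set.mem_ofPred_eq, LocalizedModule.mk_add_mk, fractionSign_mk]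
    rw [← sign_positiveScalars_smul s' m, ← sign_positiveScalars_smul s m', sign_nonneg_iff,
      sign_nonneg_iff, sign_nonneg_iff]
    exact add_nonneg
  eq_zero_of_mem_of_neg_mem' {a} := by
    induction a using LocalizedModule.induction_on with | h m s =>
    simp only [Set.mem_ofPred_eq, ← LocalizedModule.mk_neg, fractionSign_mk, sign_nonneg_iff]
    intro hm hm'
    rw [le_antisymm (neg_nonneg.1 hm') hm, LocalizedModule.zero_mk]

theorem mk_mem_fractionCone {m : V} {s : positiveScalars A V} :
    LocalizedModule.mk m s ∈ fractionCone A V ↔ 0 ≤ m := by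
  change 0 ≤ fractionSign _ ↔ _
  rw [fractionSign_mk, sign_nonneg_iff]

instance : HasMemOrNegMem (fractionCone A V) where
  mem_or_neg_mem a := by
    induction a using LocalizedModule.induction_on with | h m s =>
    rw [← LocalizedModule.mk_neg, mk_mem_fractionCone, mk_mem_fractionCone, neg_nonneg]
    exact le_total 0 m

open scoped Classical in
noncomputable instance : LinearOrder (LocalizedModule (positiveScalars A V) V) :=
  .mkOfAddGroupCone (fractionCone A V)

instance : IsOrderedAddMonoid (LocalizedModule (positiveScalars A V) V) :=
  .mkOfCone (fractionCone A V)

theorem mk_nonneg {m : V} {s : positiveScalars A V} : 0 ≤ LocalizedModule.mk m s ↔ 0 ≤ m := by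
  change LocalizedModule.mk m s - 0 ∈ fractionCone A V ↔ _
  rw [sub_zero, mk_mem_fractionCone]

theorem sign_mk (m : V) (s : positiveScalars A V) : sign (LocalizedModule.mk m s) = sign m := by
  have mk_nonpos : LocalizedModule.mk m s ≤ 0 ↔ m ≤ 0 := by
    rw [← neg_nonneg, ← LocalizedModule.mk_neg, mk_nonneg, neg_nonneg]
  simp only [sign_apply, ← not_le, mk_nonneg, mk_nonpos]

theorem mkLinearMap_strictMono :
    StrictMono (LocalizedModule.mkLinearMap (positiveScalars A V) V) := fun a b hab ↦ by
  rw [← sub_pos, ← map_sub, LocalizedModule.mkLinearMap_apply, ← sign_eq_one_iff, sign_mk,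
    sign_eq_one_iff, sub_pos]
  exact hab

theorem mem_positiveScalars_localization {p : A} (hp : p ∈ positiveScalars A V) :
    p ∈ positiveScalars A (LocalizedModule (positiveScalars A V) V) := fun z ↦ by
  induction z using LocalizedModule.induction_on with | h m s =>
  rw [LocalizedModule.smul'_mk, sign_mk, sign_mk, hp]

theorem ActsWithSign.isSignDivisible_localization {σ : A → SignType} (hσ : ActsWithSign σ V) :
    IsSignDivisible σ (LocalizedModule (positiveScalars A V) V) where
  actsWithSign p z := by
    induction z using LocalizedModule.induction_on with | h m s =>
    rw [LocalizedModule.smul'_mk, sign_mk, sign_mk, hσ]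
  surjective_smul {p} hp := by
    rcases (σ p).trichotomy with hneg | hzero | hpos
    · have hmem : -p ∈ positiveScalars A V := fun x ↦ by
        rw [neg_smul, Left.sign_neg, hσ, hneg, neg_one_mul, neg_neg]
      intro z
      obtain ⟨y, hy⟩ := smul_localization_surjective hmem z
      exact ⟨-y, by simpa only [smul_neg, neg_smul] using hy⟩
    · exact absurd hzero hp
    · exact smul_localization_surjective fun x ↦ by rw [hσ, hpos, one_mul]

end Localization

section Symbols

variable {M : Type*} [lang.Structure M]

/-- The interpretation of the symbol `ρ·`. -/
def rho (x : M) : M := Structure.funMap (L := lang) Func.rho ![x]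

/-- The interpretation of the symbol `ρ⁻¹·`. -/
def rhoInv (x : M) : M := Structure.funMap (L := lang) Func.rhoInv ![x]

theorem funMap_rho (x : Fin 1 → M) : Structure.funMap (L := lang) Func.rho x = rho (x 0) :=
  congrArg _ (List.ofFn_inj.1 rfl)

theorem funMap_rhoInv (x : Fin 1 → M) :
    Structure.funMap (L := lang) Func.rhoInv x = rhoInv (x 0) :=
  congrArg _ (List.ofFn_inj.1 rfl)

@[simp]
theorem realize_rhoT {α : Type} (t : lang.Term α) (v : α → M) :
    (rhoT t).realize v = rho (t.realize v) :=
  Term.realize_functions_apply₁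

@[simp]
theorem realize_rhoInvT {α : Type} (t : lang.Term α) (v : α → M) :
    (rhoInvT t).realize v = rhoInv (t.realize v) :=
  Term.realize_functions_apply₁

end Symbols

/-- The operations `0`, `-`, `+` and the relation `<` of `M` are the interpretations of the
corresponding symbols. -/
class CompatibleOrderedGroup (M : Type*) [lang.Structure M] [Zero M] [Neg M] [Add M] [LT M] :
    Prop where
  funMap_zero (x : Fin 0 → M) : Structure.funMap (L := lang) Func.zero x = 0
  funMap_neg (x : Fin 1 → M) : Structure.funMap (L := lang) Func.neg x = -x 0
  funMap_add (x : Fin 2 → M) : Structure.funMap (L := lang) Func.add x = x 0 + x 1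
  relMap_lt (x : Fin 2 → M) : Structure.RelMap (L := lang) Rel.lt x ↔ x 0 < x 1

open CompatibleOrderedGroup

section Axioms

variable {M : Type*} [lang.Structure M] [Zero M] [Neg M] [Add M] [LT M] [CompatibleOrderedGroup M]

section Realize

variable {α : Type}

@[simp]
theorem realize_zeroT (v : α → M) : (zeroT : lang.Term α).realize v = 0 :=
  Term.realize_constants.trans (funMap_zero _)

@[simp]
theorem realize_negT (t : lang.Term α) (v : α → M) : (negT t).realize v = -t.realize v :=
  Term.realize_functions_apply₁.trans (funMap_neg _)

@[simp]
theorem realize_addT (s t : lang.Term α) (v : α → M) :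
    (addT s t).realize v = s.realize v + t.realize v :=
  Term.realize_functions_apply₂.trans (funMap_add _)

@[simp]
theorem realize_ltF {n : ℕ} (s t : lang.Term (α ⊕ Fin n)) (v : α → M) (xs : Fin n → M) :
    (ltF s t).Realize v xs ↔ s.realize (Sum.elim v xs) < t.realize (Sum.elim v xs) :=
  BoundedFormula.realize_rel₂.trans (relMap_lt _)

end Realize

theorem models_abelianGroupAxioms_iff :
    M ⊨ abelianGroupAxioms ↔ (∀ x y z : M, x + y + z = x + (y + z)) ∧
      (∀ x y : M, x + y = y + x) ∧ (∀ x : M, x + 0 = x) ∧ ∀ x : M, x + -x = 0 := by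
  simp [abelianGroupAxioms, Theory.model_iff, Sentence.Realize, Formula.Realize, Fin.snoc]

theorem models_linearOrderAxioms_iff :
    M ⊨ linearOrderAxioms ↔ (∀ x : M, ¬x < x) ∧ (∀ x y z : M, x < y → y < z → x < z) ∧
      ∀ x y : M, (x < y ∨ x = y) ∨ y < x := by
  simp [linearOrderAxioms, Theory.model_iff, Sentence.Realize, Formula.Realize, Fin.snoc]

theorem models_orderCompatibilityAxioms_iff :
    M ⊨ orderCompatibilityAxioms ↔ (∀ x y z : M, x < y → x + z < y + z) ∧
      (∀ x y : M, x < y → rho x < rho y) ∧ ∀ x y : M, x < y → rhoInv x < rhoInv y := by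
  simp [orderCompatibilityAxioms, Theory.model_iff, Sentence.Realize, Formula.Realize, Fin.snoc]

theorem models_automorphismAxioms_iff :
    M ⊨ automorphismAxioms ↔ (∀ x y : M, rho (x + y) = rho x + rho y) ∧
      (∀ x y : M, rhoInv (x + y) = rhoInv x + rhoInv y) ∧ (∀ x : M, rho (rhoInv x) = x) ∧
        ∀ x : M, rhoInv (rho x) = x := by
  simp [automorphismAxioms, Theory.model_iff, Sentence.Realize, Formula.Realize, Fin.snoc]

theorem models_nontrivialAxiom_iff : M ⊨ nontrivialAxiom ↔ ∃ x : M, x ≠ 0 := by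
  simp [nontrivialAxiom, Sentence.Realize, Formula.Realize, Fin.snoc]

end Axioms

section OfModel

theorem exists_compatibleOrderedGroup (M : Type*) [lang.Structure M] :
    ∃ (_ : Zero M) (_ : Neg M) (_ : Add M) (_ : LT M), CompatibleOrderedGroup M :=
  let _ : Zero M := ⟨Structure.funMap (L := lang) Func.zero ![]⟩
  let _ : Neg M := ⟨fun x ↦ Structure.funMap (L := lang) Func.neg ![x]⟩
  let _ : Add M := ⟨fun x y ↦ Structure.funMap (L := lang) Func.add ![x, y]⟩
  let _ : LT M := ⟨fun x y ↦ Structure.RelMap (L := lang) Rel.lt ![x, y]⟩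
  ⟨_, _, _, _,
    { funMap_zero _ := congrArg _ (Subsingleton.elim _ _)
      funMap_neg _ := congrArg _ (List.ofFn_inj.1 rfl)
      funMap_add _ := congrArg _ (List.ofFn_inj.1 rfl)
      relMap_lt _ := iff_of_eq (congrArg _ (List.ofFn_inj.1 rfl)) }⟩

variable {M : Type*} [lang.Structure M]

section

variable [Zero M] [Neg M] [Add M] [LT M] [CompatibleOrderedGroup M]

/-- The abelian group underlying a model of the axioms of abelian groups. -/
abbrev addCommGroupOfModels (h : M ⊨ abelianGroupAxioms) : AddCommGroup M :=
  have axioms := models_abelianGroupAxioms_iff.1 h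
  { add_assoc := axioms.1
    add_comm := axioms.2.1
    add_zero := axioms.2.2.1
    zero_add x := by rw [axioms.2.1, axioms.2.2.1]
    neg_add_cancel x := by rw [axioms.2.1, axioms.2.2.2]
    nsmul := nsmulRec
    zsmul := zsmulRec }

open scoped Classical in
/-- The linear order underlying a model of the axioms of linear orders. -/
noncomputable abbrev linearOrderOfModels (h : M ⊨ linearOrderAxioms) : LinearOrder M :=
  have axioms := models_linearOrderAxioms_iff.1 h
  have : IsStrictTotalOrder M (· < ·) :=
    { irrefl := axioms.1
      trans := axioms.2.1
      trichotomous x y hxy hyx := by simpa [hxy, hyx] using axioms.2.2 x y }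
  linearOrderOfSTO (· < ·)

end

theorem exists_compatibleOrderedGroup_of_models (hM : M ⊨ orderedDifferenceAbelianGroups) :
    ∃ (_ : AddCommGroup M) (_ : LinearOrder M),
      IsOrderedAddMonoid M ∧ CompatibleOrderedGroup M := by
  simp only [orderedDifferenceAbelianGroups, Theory.model_union_iff] at hM
  obtain ⟨⟨⟨hgroup, horder⟩, hcompatible⟩, -⟩ := hM
  obtain ⟨_, _, _, _, _⟩ := exists_compatibleOrderedGroup M
  have add_lt_add_right := (models_orderCompatibilityAxioms_iff.1 hcompatible).1
  let _ := addCommGroupOfModels hgroup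
  let _ := linearOrderOfModels horder
  have := IsOrderedCancelAddMonoid.of_add_lt_add_left fun x y z : M ↦ by
    simpa only [add_comm x] using add_lt_add_right y z x
  exact ⟨_, _, inferInstance, ‹_›⟩

end OfModel

/-- The action of Laurent polynomials on an abelian group for which the variable acts as the
automorphism `u`. -/
noncomputable abbrev laurentModule {M : Type*} [AddCommGroup M] (u : (AddMonoid.End M)ˣ) :
    Module ℤ[T;T⁻¹] M :=
  Module.compHom M (AddMonoidAlgebra.lift ℤ (AddMonoid.End M) ℤ
    ((Units.coeHom _).comp (zpowersHom _ u))).toRingHom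

theorem laurentModule_T_smul {M : Type*} [AddCommGroup M] (u : (AddMonoid.End M)ˣ) (n : ℤ) (x : M) :
    letI := laurentModule u
    (T n : ℤ[T;T⁻¹]) • x = (u ^ n : (AddMonoid.End M)ˣ).1 x :=
  DFunLike.congr_fun ((AddMonoidAlgebra.lift_single _ _ _).trans (one_smul _ _)) x

/-- An ordered module over the Laurent polynomials whose operations are the interpretations of the
symbols, the variable `T 1` acting as `ρ`. -/
class CompatibleModule (M : Type*) [lang.Structure M] [AddCommGroup M] [LT M]
    [Module ℤ[T;T⁻¹] M] : Prop extends CompatibleOrderedGroup M where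
  rho_eq (x : M) : rho x = (T 1 : ℤ[T;T⁻¹]) • x
  rhoInv_eq (x : M) : rhoInv x = (T (-1) : ℤ[T;T⁻¹]) • x

open CompatibleModule

theorem exists_compatibleModule {M : Type*} [lang.Structure M]
    (hM : M ⊨ orderedDifferenceAbelianGroups) :
    ∃ (_ : AddCommGroup M) (_ : LinearOrder M) (_ : Module ℤ[T;T⁻¹] M),
      IsOrderedAddMonoid M ∧ CompatibleModule M ∧
        T 1 ∈ positiveScalars ℤ[T;T⁻¹] M := by
  obtain ⟨_, _, _, _⟩ := exists_compatibleOrderedGroup_of_models hM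
  simp only [orderedDifferenceAbelianGroups, Theory.model_union_iff] at hM
  obtain ⟨⟨-, hcompatible⟩, hautomorphism⟩ := hM
  obtain ⟨-, rho_strictMono, -⟩ := models_orderCompatibilityAxioms_iff.1 hcompatible
  obtain ⟨rho_add, rhoInv_add, rho_rhoInv, rhoInv_rho⟩ :=
    models_automorphismAxioms_iff.1 hautomorphism
  let u : (AddMonoid.End M)ˣ :=
    { val := AddMonoidHom.mk' rho rho_add
      inv := AddMonoidHom.mk' rhoInv rhoInv_add
      val_inv := AddMonoidHom.ext rho_rhoInv
      inv_val := AddMonoidHom.ext rhoInv_rho }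
  let _ := laurentModule u
  have rho_eq (x : M) : rho x = (T 1 : ℤ[T;T⁻¹]) • x := by
    rw [laurentModule_T_smul, zpow_one]; rfl
  have rhoInv_eq (x : M) : rhoInv x = (T (-1) : ℤ[T;T⁻¹]) • x := by
    rw [laurentModule_T_smul, zpow_neg_one]; rfl
  refine ⟨_, _, _, ‹_›, ⟨rho_eq, rhoInv_eq⟩, fun x ↦ ?_⟩
  rw [← rho_eq]
  exact StrictMono.sign_comp (f := u.val) (fun x y ↦ rho_strictMono x y) x

section Operators

variable {M : Type*} [lang.Structure M] {α : Type} (t : lang.Term α) (v : α → M)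

section

variable [AddGroup M] [LT M] [CompatibleOrderedGroup M]

theorem realize_natMulT (m : ℕ) : (natMulT m t).realize v = m • t.realize v := by
  induction m with
  | zero => rw [natMulT, realize_zeroT, zero_nsmul]
  | succ m ih => rw [natMulT, realize_addT, ih, succ_nsmul]

theorem realize_intMulT (m : ℤ) : (intMulT m t).realize v = m • t.realize v := by
  cases m with
  | ofNat m => rw [intMulT, realize_natMulT, Int.ofNat_eq_natCast, natCast_zsmul]
  | negSucc m => rw [intMulT, realize_negT, realize_natMulT, negSucc_zsmul]

end

variable [AddCommGroup M] [LT M] [Module ℤ[T;T⁻¹] M] [CompatibleModule M]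

theorem realize_rhoPowT (i : ℕ) :
    (rhoPowT i t).realize v = (T i : ℤ[T;T⁻¹]) • t.realize v := by
  induction i with
  | zero => rw [rhoPowT, Nat.cast_zero, T_zero, one_smul]
  | succ i ih => rw [rhoPowT, realize_rhoT, rho_eq, ih, smul_smul, ← T_add, add_comm, Nat.cast_succ]

theorem realize_partialOpT (p : ℤ[X]) (k : ℕ) :
    (partialOpT p t k).realize v =
      (∑ i ∈ Finset.range k, C (p.coeff i) * T i : ℤ[T;T⁻¹]) • t.realize v := by
  induction k with
  | zero => rw [partialOpT, realize_zeroT, Finset.sum_range_zero, zero_smul]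
  | succ k ih =>
    rw [partialOpT, realize_addT, ih, realize_intMulT, realize_rhoPowT, Finset.sum_range_succ,
      add_smul, mul_smul, ← Int.cast_smul_eq_zsmul ℤ[T;T⁻¹]]
    simp

theorem realize_opT (p : ℤ[X]) : (opT p t).realize v = p.toLaurent • t.realize v := by
  rw [opT, realize_partialOpT]
  conv_rhs => rw [p.as_sum_range_C_mul_X_pow, map_sum]
  simp only [Polynomial.toLaurent_C_mul_X_pow]

variable {p : ℤ[X]}

theorem models_divisibilityAxiom_iff :
    M ⊨ divisibilityAxiom p ↔
      (∀ x : M, p.toLaurent • x = 0) ∨ ∀ x : M, ∃ y : M, p.toLaurent • y = x := by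
  simp [divisibilityAxiom, Sentence.Realize, Formula.Realize, realize_opT, Fin.snoc]

theorem models_axiomOM_iff :
    M ⊨ axiomOM p ↔
      ((∀ x : M, 0 < x → 0 < p.toLaurent • x) ∨ ∀ x : M, 0 < x → p.toLaurent • x = 0) ∨
        ∀ x : M, 0 < x → p.toLaurent • x < 0 := by
  simp [axiomOM, Sentence.Realize, Formula.Realize, realize_opT, Fin.snoc]

end Operators

section Models

section Divisibility

variable {V : Type*} [AddCommGroup V] [LinearOrder V] [Module ℤ[T;T⁻¹] V]

theorem T_natCast_mem_positiveScalars (hT : T 1 ∈ positiveScalars ℤ[T;T⁻¹] V) (n : ℕ) :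
    T n ∈ positiveScalars ℤ[T;T⁻¹] V := by
  simpa only [T_pow, mul_one] using pow_mem hT n

theorem exists_actsWithSign_iff (hT : T 1 ∈ positiveScalars ℤ[T;T⁻¹] V) :
    (∃ σ : ℤ[T;T⁻¹] → SignType, ActsWithSign σ V) ↔
      ∀ p : ℤ[X], ∃ s : SignType, ∀ x : V, sign (p.toLaurent • x) = s * sign x := by
  refine ⟨fun ⟨σ, hσ⟩ p ↦ ⟨σ p.toLaurent, hσ _⟩, fun h ↦ ?_⟩
  have exists_sign (q : ℤ[T;T⁻¹]) : ∃ s : SignType, ∀ x : V, sign (q • x) = s * sign x := by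
    obtain ⟨n, p, hp⟩ := q.exists_T_pow
    obtain ⟨s, hs⟩ := h p
    refine ⟨s, fun x ↦ ?_⟩
    rw [← hs, hp, mul_comm, mul_smul, T_natCast_mem_positiveScalars hT]
  exact Classical.axiomOfChoice exists_sign

theorem ActsWithSign.isSignDivisible_iff [IsOrderedAddMonoid V] [Nontrivial V]
    {σ : ℤ[T;T⁻¹] → SignType} (hσ : ActsWithSign σ V) (hT : T 1 ∈ positiveScalars ℤ[T;T⁻¹] V) :
    IsSignDivisible σ V ↔ ∀ p : ℤ[X],
      (∀ x : V, p.toLaurent • x = 0) ∨ ∀ x : V, ∃ y : V, p.toLaurent • y = x := by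
  constructor
  · intro h p
    by_cases hp : σ p.toLaurent = 0
    · exact .inl (hσ.smul_eq_zero hp)
    · exact .inr (h.surjective_smul hp)
  · refine fun h ↦ ⟨hσ, fun {q} hq x ↦ ?_⟩
    obtain ⟨n, p, hp⟩ := q.exists_T_pow
    rcases h p with hzero | hsurj
    · obtain ⟨y, hy⟩ := exists_pos_of_nontrivial V
      rw [← hσ.sign_smul_of_pos q hy, ← T_natCast_mem_positiveScalars hT n, ← mul_smul, mul_comm,
        ← hp, hzero, sign_zero] at hq
      exact absurd rfl hq
    · obtain ⟨y, hy⟩ := hsurj x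
      exact ⟨(T n : ℤ[T;T⁻¹]) • y, by rw [← hy, hp, mul_smul]⟩

end Divisibility

variable {M : Type*} [lang.Structure M] [AddCommGroup M] [LinearOrder M] [IsOrderedAddMonoid M]
  [Module ℤ[T;T⁻¹] M] [CompatibleModule M]

theorem models_orderedDifferenceAbelianGroups (hT : T 1 ∈ positiveScalars ℤ[T;T⁻¹] M) :
    M ⊨ orderedDifferenceAbelianGroups := by
  have smul_T_inv (m n : ℤ) (hmn : m + n = 0) (x : M) :
      (T m : ℤ[T;T⁻¹]) • (T n : ℤ[T;T⁻¹]) • x = x := by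
    rw [smul_smul, ← T_add, hmn, T_zero, one_smul]
  have hT' : T (-1) ∈ positiveScalars ℤ[T;T⁻¹] M := fun x ↦ by
    rw [← hT, smul_T_inv 1 (-1) rfl]
  simp only [orderedDifferenceAbelianGroups, Theory.model_union_iff,
    models_abelianGroupAxioms_iff, models_linearOrderAxioms_iff,
    models_orderCompatibilityAxioms_iff, models_automorphismAxioms_iff, rho_eq,
    rhoInv_eq]
  exact ⟨⟨⟨⟨add_assoc, add_comm, add_zero, add_neg_cancel⟩,
    lt_irrefl, fun _ _ _ ↦ lt_trans, fun x y ↦ or_assoc.2 (lt_trichotomy x y)⟩,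
    fun _ _ z h ↦ add_lt_add_left h z, strictMono_smul hT, strictMono_smul hT'⟩,
    smul_add _, smul_add _, smul_T_inv 1 (-1) rfl, smul_T_inv (-1) 1 rfl⟩

theorem models_MODAG_iff (hT : T 1 ∈ positiveScalars ℤ[T;T⁻¹] M) :
    M ⊨ MODAG ↔ ∃ σ : ℤ[T;T⁻¹] → SignType, ActsWithSign σ M := by
  simp only [Theory.model_union_iff, MODAG, models_orderedDifferenceAbelianGroups hT, true_and,
    Theory.model_iff (Set.range _), Set.forall_mem_range, models_axiomOM_iff,
    exists_actsWithSign_iff hT, exists_sign_smul_iff]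

theorem models_MODDAG_iff (hT : T 1 ∈ positiveScalars ℤ[T;T⁻¹] M) :
    M ⊨ MODDAG ↔ Nontrivial M ∧ ∃ σ : ℤ[T;T⁻¹] → SignType, IsSignDivisible σ M := by
  simp only [Theory.model_union_iff, MODDAG, models_MODAG_iff hT, Theory.model_singleton_iff,
    models_nontrivialAxiom_iff, Theory.model_iff (Set.range _), Set.forall_mem_range,
    models_divisibilityAxiom_iff]
  constructor
  · rintro ⟨⟨⟨σ, hσ⟩, x, hx⟩, h⟩
    have : Nontrivial M := ⟨x, 0, hx⟩
    exact ⟨this, σ, (hσ.isSignDivisible_iff hT).2 h⟩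
  · rintro ⟨_, σ, hσ⟩
    exact ⟨⟨⟨σ, hσ.actsWithSign⟩, exists_ne 0⟩, (hσ.actsWithSign.isSignDivisible_iff hT).1 hσ⟩

end Models

section Embeddings

/-- An ordered module over the Laurent polynomials as a structure for the language of ordered
difference groups, `ρ` and its inverse being `T 1` and `T (-1)`. -/
noncomputable abbrev laurentStructure (V : Type*) [AddCommGroup V] [LT V] [Module ℤ[T;T⁻¹] V] :
    lang.Structure V where
  funMap {_} f x := match f with
    | Func.zero => 0
    | Func.neg => -x 0
    | Func.rho => (T 1 : ℤ[T;T⁻¹]) • x 0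
    | Func.rhoInv => (T (-1) : ℤ[T;T⁻¹]) • x 0
    | Func.add => x 0 + x 1
  RelMap {_} r x := match r with
    | Rel.lt => x 0 < x 1

theorem compatibleModule_laurentStructure (V : Type*) [AddCommGroup V] [LT V]
    [Module ℤ[T;T⁻¹] V] : @CompatibleModule V (laurentStructure V) _ _ _ :=
  let _ := laurentStructure V
  { funMap_zero _ := rfl
    funMap_neg _ := rfl
    funMap_add _ := rfl
    relMap_lt _ := Iff.rfl
    rho_eq _ := rfl
    rhoInv_eq _ := rfl }

variable {M N : Type*} [lang.Structure M] [lang.Structure N]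
  [AddCommGroup M] [LinearOrder M] [Module ℤ[T;T⁻¹] M] [CompatibleModule M]
  [AddCommGroup N] [LinearOrder N] [Module ℤ[T;T⁻¹] N] [CompatibleModule N]

theorem nonempty_embedding_of_strictMono {f : M →ₗ[ℤ[T;T⁻¹]] N} (hf : StrictMono f) :
    Nonempty (M ↪[lang] N) :=
  ⟨{  toFun := f
      inj' := hf.injective
      map_fun' {_} g x := by
        cases (g : Func _) <;>
        simp [funMap_zero, funMap_neg, funMap_add, funMap_rho, funMap_rhoInv, rho_eq, rhoInv_eq]
      map_rel' {_} r x := by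
        cases (r : Rel _)
        rw [relMap_lt, relMap_lt]
        exact hf.lt_iff_lt }⟩

theorem exists_linearMap_of_embedding (f : M ↪[lang] N) :
    ∃ g : M →ₗ[ℤ[T;T⁻¹]] N, StrictMono g ∧ ⇑g = f := by
  have map_add (x y : M) : f (x + y) = f x + f y := by
    simpa [funMap_add] using f.map_fun Func.add ![x, y]
  have map_rho (x : M) : f (rho x) = rho (f x) := by
    simpa [funMap_rho] using f.map_fun Func.rho ![x]
  have map_rhoInv (x : M) : f (rhoInv x) = rhoInv (f x) := by
    simpa [funMap_rhoInv] using f.map_fun Func.rhoInv ![x]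
  have map_lt (x y : M) : f x < f y ↔ x < y := by
    simpa [relMap_lt] using f.map_rel Rel.lt ![x, y]
  let g : M →+ N := AddMonoidHom.mk' f map_add
  have map_smul (p : ℤ[T;T⁻¹]) : ∀ x : M, g (p • x) = p • g x := by
    induction p using LaurentPolynomial.induction_on with
    | h_C a =>
      exact fun x ↦ by
        rw [eq_intCast C a, Int.cast_smul_eq_zsmul, Int.cast_smul_eq_zsmul, map_zsmul]
    | h_add hp hq => exact fun x ↦ by rw [add_smul, add_smul, g.map_add, hp, hq]
    | h_C_mul_T n a h =>
      intro x
      rw [T_add, ← mul_assoc, mul_smul, h, mul_smul _ (T 1), ← rho_eq, ← rho_eq]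
      exact congrArg _ (map_rho x)
    | h_C_mul_T_Z n a h =>
      intro x
      rw [sub_eq_add_neg, T_add, ← mul_assoc, mul_smul, h, mul_smul _ (T (-1)),
        ← rhoInv_eq, ← rhoInv_eq]
      exact congrArg _ (map_rhoInv x)
  exact ⟨{ g with map_smul' := map_smul }, fun x y ↦ (map_lt x y).2, rfl⟩

end Embeddings

section Extension

/-- Endomorphisms of `ℤ` are multiplications, so every action on `ℤ` satisfies Axiom OM. -/
theorem actsWithSign_int {A : Type*} [CommRing A] [Module A (ULift ℤ)] :
    ActsWithSign (fun p : A ↦ sign (p • (1 : ULift ℤ))) (ULift ℤ) := fun p x ↦ by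
  have eq_zsmul_one : x = x.down • (1 : ULift ℤ) := ULift.ext _ _ (by simp)
  have smul_down : (p • x).down = (p • (1 : ULift ℤ)).down * x.down := by
    rw [eq_zsmul_one, smul_comm]
    simp [mul_comm]
  exact (congrArg sign smul_down).trans (sign_mul _ _)

theorem exists_nontrivial_extension {V : Type w} [AddCommGroup V] [LinearOrder V]
    [IsOrderedAddMonoid V] [Module ℤ[T;T⁻¹] V] {σ : ℤ[T;T⁻¹] → SignType} (hσ : ActsWithSign σ V)
    (hT : T 1 ∈ positiveScalars ℤ[T;T⁻¹] V) :
    ∃ (W : Type w) (_ : AddCommGroup W) (_ : LinearOrder W) (_ : IsOrderedAddMonoid W)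
      (_ : Module ℤ[T;T⁻¹] W) (f : V →ₗ[ℤ[T;T⁻¹]] W) (τ : ℤ[T;T⁻¹] → SignType),
      StrictMono f ∧ Nontrivial W ∧ T 1 ∈ positiveScalars ℤ[T;T⁻¹] W ∧ ActsWithSign τ W := by
  rcases subsingleton_or_nontrivial V with _ | _
  · let _ := laurentModule (M := ULift.{w} ℤ) 1
    refine ⟨ULift.{w} ℤ, _, inferInstance,
      Function.Injective.isOrderedAddMonoid ULift.down (fun _ _ ↦ rfl) .rfl, _, 0, _,
      Subsingleton.strictMono _, inferInstance, fun x ↦ ?_, actsWithSign_int⟩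
    rw [laurentModule_T_smul, one_zpow]
    rfl
  · exact ⟨V, _, _, ‹_›, _, .id, σ, strictMono_id, ‹_›, hT, hσ⟩

theorem modelsEmbedInto_MODDAG : Theory.ModelsEmbedInto.{0, 0, w} MODAG MODDAG := by
  intro M _ _ hM
  obtain ⟨_, _, _, _, _, hT⟩ :=
    exists_compatibleModule (Theory.model_union_iff.1 hM).1
  obtain ⟨σ, hσ⟩ := (models_MODAG_iff hT).1 hM
  obtain ⟨V, _, _, _, _, f, τ, hf, _, hTV, hτ⟩ := exists_nontrivial_extension hσ hT
  let N := LocalizedModule (positiveScalars ℤ[T;T⁻¹] V) V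
  let _ := laurentStructure N
  have := compatibleModule_laurentStructure N
  have hN : N ⊨ MODDAG := (models_MODDAG_iff (mem_positiveScalars_localization hTV)).2
    ⟨mkLinearMap_strictMono.injective.nontrivial, τ, hτ.isSignDivisible_localization⟩
  exact ⟨N, _, ⟨0⟩, hN, nonempty_embedding_of_strictMono
    (f := (LocalizedModule.mkLinearMap _ V).comp f) (mkLinearMap_strictMono.comp hf)⟩

theorem modelsEmbedInto_MODAG : Theory.ModelsEmbedInto.{0, 0, w} MODDAG MODAG :=
  fun M _ hne hM ↦ ⟨M, _, hne,
    hM.mono (Set.subset_union_left.trans Set.subset_union_left), ⟨Embedding.refl lang M⟩⟩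

end Extension

section ModelCompleteness

/-- The linear form computed by a term, given by its coefficients. -/
noncomputable def linearForm {β : Type*} : lang.Term β → (β →₀ ℤ[T;T⁻¹])
  | .var i => Finsupp.single i 1
  | .func Func.zero _ => 0
  | .func Func.neg ts => -linearForm (ts 0)
  | .func Func.rho ts => (T 1 : ℤ[T;T⁻¹]) • linearForm (ts 0)
  | .func Func.rhoInv ts => (T (-1) : ℤ[T;T⁻¹]) • linearForm (ts 0)
  | .func Func.add ts => linearForm (ts 0) + linearForm (ts 1)

theorem realize_eq_linearCombination {M β : Type*} [lang.Structure M] [AddCommGroup M] [LT M]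
    [Module ℤ[T;T⁻¹] M] [CompatibleModule M] (t : lang.Term β) (v : β → M) :
    t.realize v = Finsupp.linearCombination ℤ[T;T⁻¹] v (linearForm t) := by
  induction t with
  | var i => simp [linearForm]
  | func f ts ih =>
    cases (f : Func _) <;>
      simp [linearForm, Term.realize, ih, funMap_zero, funMap_neg, funMap_add, funMap_rho,
        funMap_rhoInv, rho_eq, rhoInv_eq]

/-- The variables of a formula with its last bound variable singled out as `none`. -/
def splitLast {α : Type*} {n : ℕ} : α ⊕ Fin (n + 1) → Option (α ⊕ Fin n) :=
  Sum.elim (some ∘ .inl) (Fin.lastCases none (some ∘ .inr))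

theorem elim_comp_splitLast {α M : Type*} {n : ℕ} (v : α → M) (xs : Fin n → M) (a : M) :
    (Option.elim · a (Sum.elim v xs)) ∘ splitLast = Sum.elim v (Fin.snoc xs a) := by
  funext i
  rcases i with i | i
  · rfl
  · cases i using Fin.lastCases <;> simp [splitLast]

/-- A set of linear forms whose signs determine the truth of a formula in the nontrivial
sign-divisible ordered modules. -/
noncomputable def testForms {α : Type*} {n : ℕ} :
    lang.BoundedFormula α n → Set (α ⊕ Fin n →₀ ℤ[T;T⁻¹])
  | .falsum => ∅
  | .equal s t => {linearForm s - linearForm t}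
  | .rel Rel.lt ts => {linearForm (ts 0) - linearForm (ts 1)}
  | .imp φ ψ => testForms φ ∪ testForms ψ
  | .all φ => eliminate (Finsupp.mapDomain splitLast '' testForms φ)

theorem testForms_finite {α : Type*} {n : ℕ} (φ : lang.BoundedFormula α n) :
    (testForms φ).Finite := by
  induction φ with
  | falsum => exact Set.finite_empty
  | equal s t => exact Set.finite_singleton _
  | rel R ts =>
    cases (R : Rel _)
    exact Set.finite_singleton _
  | imp φ ψ hφ hψ => exact hφ.union hψ
  | all φ hφ => exact eliminate_finite (hφ.image _)

theorem sameSigns_image_mapDomain {A ι κ V W : Type*} [CommRing A]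
    [AddCommGroup V] [LinearOrder V] [Module A V] [AddCommGroup W] [LinearOrder W] [Module A W]
    {f : ι → κ} {S : Set (ι →₀ A)} {x : κ → V} {y : κ → W} :
    SameSigns (Finsupp.mapDomain f '' S) x y ↔ SameSigns S (x ∘ f) (y ∘ f) := by
  simp only [SameSigns, Set.forall_mem_image, Finsupp.linearCombination_mapDomain]

section

variable {M N : Type*} [AddCommGroup M] [LinearOrder M] [IsOrderedAddMonoid M]
  [Module ℤ[T;T⁻¹] M] [AddCommGroup N] [LinearOrder N] [IsOrderedAddMonoid N]
  [Module ℤ[T;T⁻¹] N] [Nontrivial N] {σ : ℤ[T;T⁻¹] → SignType}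

theorem SameSigns.exists_snoc (hM : IsSignDivisible σ M) (hN : IsSignDivisible σ N)
    {α : Type*} {n : ℕ} {φ : lang.BoundedFormula α (n + 1)} {v : α → M} {xs : Fin n → M}
    {w : α → N} {ys : Fin n → N}
    (h : SameSigns (testForms φ.all) (Sum.elim v xs) (Sum.elim w ys)) (a : M) :
    ∃ b : N, SameSigns (testForms φ) (Sum.elim v (Fin.snoc xs a)) (Sum.elim w (Fin.snoc ys b)) := by
  obtain ⟨b, hb⟩ := h.exists_extend hM hN ((testForms_finite φ).image _) a
  refine ⟨b, ?_⟩
  rwa [sameSigns_image_mapDomain, elim_comp_splitLast, elim_comp_splitLast] at hb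

theorem realize_iff_of_sameSigns [lang.Structure M] [lang.Structure N] [CompatibleModule M]
    [CompatibleModule N] [Nontrivial M] (hM : IsSignDivisible σ M) (hN : IsSignDivisible σ N)
    {α : Type*} {n : ℕ} (φ : lang.BoundedFormula α n) {v : α → M} {xs : Fin n → M} {w : α → N}
    {ys : Fin n → N} (h : SameSigns (testForms φ) (Sum.elim v xs) (Sum.elim w ys)) :
    φ.Realize v xs ↔ φ.Realize w ys := by
  induction φ with
  | falsum => exact Iff.rfl
  | equal s t =>
    have := h _ rfl
    rw [LinearMap.map_sub, LinearMap.map_sub] at this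
    simp only [BoundedFormula.Realize, realize_eq_linearCombination]
    rw [← sub_eq_zero, ← sign_eq_zero_iff, this, sign_eq_zero_iff, sub_eq_zero]
  | rel R ts =>
    cases (R : Rel _)
    have := h _ rfl
    rw [LinearMap.map_sub, LinearMap.map_sub] at this
    simp only [BoundedFormula.Realize, relMap_lt, realize_eq_linearCombination]
    rw [← sub_neg, ← sign_eq_neg_one_iff, this, sign_eq_neg_one_iff, sub_neg]
  | imp φ ψ hφ hψ =>
    exact imp_congr (hφ (h.mono Set.subset_union_left)) (hψ (h.mono Set.subset_union_right))
  | all φ hφ =>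
    constructor
    · intro hall b
      obtain ⟨a, ha⟩ := h.symm.exists_snoc hN hM b
      exact (hφ ha.symm).1 (hall a)
    · intro hall a
      obtain ⟨b, hb⟩ := h.exists_snoc hM hN a
      exact (hφ hb).2 (hall b)

end

theorem exists_compatibleModule_isSignDivisible {M : Type*} [lang.Structure M]
    (hM : M ⊨ MODDAG) :
    ∃ (_ : AddCommGroup M) (_ : LinearOrder M) (_ : Module ℤ[T;T⁻¹] M),
      IsOrderedAddMonoid M ∧ CompatibleModule M ∧ Nontrivial M ∧
        ∃ σ : ℤ[T;T⁻¹] → SignType, IsSignDivisible σ M := by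
  have hgroup : M ⊨ orderedDifferenceAbelianGroups :=
    hM.mono (Set.subset_union_left.trans (Set.subset_union_left.trans Set.subset_union_left))
  obtain ⟨_, _, _, _, _, hT⟩ := exists_compatibleModule hgroup
  exact ⟨_, _, _, ‹_›, ‹_›, (models_MODDAG_iff hT).1 hM⟩

theorem isModelComplete_MODDAG : Theory.IsModelComplete.{0, 0, w} MODDAG := by
  intro M N _ _ _ _ hM hN f n φ x
  obtain ⟨_, _, _, _, _, _, σ, hσ⟩ := exists_compatibleModule_isSignDivisible hM
  obtain ⟨_, _, _, _, _, _, τ, hτ⟩ := exists_compatibleModule_isSignDivisible hN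
  obtain ⟨g, hg, hgf⟩ := exists_linearMap_of_embedding f
  obtain rfl : σ = τ := hσ.actsWithSign.unique (hτ.actsWithSign.of_strictMono hg)
  have same_signs := sameSigns_of_strictMono (testForms φ) (Sum.elim x default) hg
  rw [Sum.comp_elim, Subsingleton.elim (g ∘ default) default] at same_signs
  rw [← hgf]
  exact realize_iff_of_sameSigns hτ hσ φ same_signs

end ModelCompleteness

end OrderedDifferenceGroup

theorem theorem2p6 :
    FirstOrder.Language.Theory.IsModelCompanion.{0, 0, w}
      OrderedDifferenceGroup.MODDAG OrderedDifferenceGroup.MODAG :=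
  ⟨OrderedDifferenceGroup.modelsEmbedInto_MODDAG, OrderedDifferenceGroup.modelsEmbedInto_MODAG,
    OrderedDifferenceGroup.isModelComplete_MODDAG⟩
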